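/- Throughout, all groups are abelian and written additively. A group $G$ is *relatively co-Hopfian* if it is not isomorphic to a proper direct summand of any of its proper subgroups; it is *reduced* if its only divisible subgroup is $\{0\}$; and it is *algebraically compact* if it is a direct summand of every group that contains it as a pure subgroup, where a subgroup $P\le H$ is *pure* if $nH\cap P=nP$ for every integer $n$. For a prime $p$, let $\widehat{\mathbb Z}_p$ denote the additive group of $p$-adic integers. **Proposition.** Let $G$ be a reduced, algebraically compact, torsion-free group. Then $G$ is relatively co-Hopfian if and only if there are an integer $n\ge 0$ and primes $p_1,\dots,p_n$, not necessarily distinct, such that $$G\;\cong\;\widehat{\mathbb Z}_{p_1}\oplus\cdots\oplus\widehat{\mathbb Z}_{p_n}$$ (for $n=0$ the right-hand side is the zero group). -/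

import Mathlib

universe u

open scoped DirectSum

namespace AbelianGroup

/-- `H = A ⊕ B` (internally) for some `B`; in particular `A ≤ H`. -/
def IsDirectSummandOf {G : Type*} [AddCommGroup G] (A H : AddSubgroup G) : Prop :=
  ∃ B : AddSubgroup G, A ⊓ B = ⊥ ∧ A ⊔ B = H

/-- `G` is relatively co-Hopfian: it is not isomorphic to a proper direct summand of any of
its proper subgroups. -/
def IsRelativelyCoHopfian (G : Type*) [AddCommGroup G] : Prop :=
  ∀ H A : AddSubgroup G, H ≠ ⊤ → IsDirectSummandOf A H → A ≠ H → IsEmpty (G ≃+ A)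

/-- A subgroup `D` is divisible: `n D = D` for all nonzero `n`. -/
def IsDivisibleSubgroup {G : Type*} [AddCommGroup G] (D : AddSubgroup G) : Prop :=
  ∀ n : ℕ, n ≠ 0 → ∀ x ∈ D, ∃ y ∈ D, n • y = x

/-- `G` is reduced: its only divisible subgroup is zero. -/
def IsReducedGroup (G : Type*) [AddCommGroup G] : Prop :=
  ∀ D : AddSubgroup G, IsDivisibleSubgroup D → D = ⊥

/-- A subgroup `P` of `H` is pure: `n H ∩ P = n P` for all `n`. -/
def IsPureSubgroup {H : Type*} [AddCommGroup H] (P : AddSubgroup H) : Prop :=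
  ∀ (n : ℕ) (h : H), n • h ∈ P → ∃ x ∈ P, n • x = n • h

/-- `G` is algebraically compact: it is a direct summand of every abelian group that contains it
as a pure subgroup. (The overgroups range over the universe of `G`; since every abelian group is
a pure subgroup of an algebraically compact group of the same universe, larger universes give
the same notion.) -/
def IsAlgebraicallyCompact (G : Type u) [AddCommGroup G] : Prop :=
  ∀ (H : Type u) [AddCommGroup H] (i : G →+ H), Function.Injective i →
    IsPureSubgroup i.range → IsDirectSummandOf i.range ⊤

end AbelianGroup

namespace AbelianGroup

/-! A reduced torsion-free `G` is detected prime by prime: an element divisible by all powers of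
every prime is zero. Algebraic compactness lets maps prescribed separately at each prime `p`, modulo
`powDivisible G p`, be glued into one map to `G` (`exists_hom_extending`). Relative co-Hopficity
forces injective endomorphisms to have torsion cokernel (`IsRelativelyCoHopfian.exists_nsmul_eq`).

Two glued endomorphisms exploit this. Multiplication by `p` at every `p` shows that `pG ≠ G` for
only finitely many `p`; a shift of a basis of `G/pG` shows that each `G/pG` is finite. With finite
bases, gluing also yields an isomorphism from a product of powers of the `ℤ_[p]` onto `G`, and only
finitely many factors survive.

Conversely, an injective endomorphism of a finite product of `ℤ_[p]`'s preserves the block of each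
prime, is linear there, and has torsion cokernel by rank; a complement of an isomorphic copy of `G`
is then torsion, hence zero. -/

/-! ### Divisibility prime by prime -/

theorem exists_nsmul_of_coprime {G : Type*} [AddCommGroup G] {a b : ℕ} (hab : a.Coprime b)
    {x y z : G} (hy : a • y = x) (hz : b • z = x) : ∃ w, (a * b) • w = x := by
  have hbez : (1 : ℤ) = a * a.gcdA b + b * a.gcdB b := by
    rw [← Nat.gcd_eq_gcd_ab, hab.gcd_eq_one, Nat.cast_one]
  refine ⟨a.gcdA b • z + a.gcdB b • y, ?_⟩
  rw [← natCast_zsmul] at hy hz ⊢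
  calc ((a * b : ℕ) : ℤ) • (a.gcdA b • z + a.gcdB b • y)
      = ((a : ℤ) * a.gcdA b) • ((b : ℤ) • z) + ((b : ℤ) * a.gcdB b) • ((a : ℤ) • y) := by
        push_cast; module
    _ = (1 : ℤ) • x := by rw [hy, hz, ← add_smul, ← hbez]
    _ = x := one_smul _ _

/-- Divisibility by `n` can be tested at the prime powers dividing `n`. -/
theorem exists_nsmul_of_primePow {G : Type*} [AddCommGroup G] (x : G) (n : ℕ) (hn : n ≠ 0) :
    (∀ p k : ℕ, p.Prime → p ^ k ∣ n → ∃ y, p ^ k • y = x) → ∃ y, n • y = x := by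
  induction n using Nat.recOnPosPrimePosCoprime with
  | zero => exact absurd rfl hn
  | one => exact fun _ => ⟨x, one_nsmul x⟩
  | prime_pow p k hp _ => exact fun h => h p k hp dvd_rfl
  | coprime a b ha hb hab iha ihb =>
    intro h
    obtain ⟨y, hy⟩ := iha (by lia) fun p k hp hd => h p k hp (hd.mul_right b)
    obtain ⟨z, hz⟩ := ihb (by lia) fun p k hp hd => h p k hp (hd.mul_left a)
    exact exists_nsmul_of_coprime hab hy hz

/-- The subgroup of elements divisible by all powers of `p`. -/
def powDivisible (G : Type*) [AddCommGroup G] (p : ℕ) : AddSubgroup G :=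
  ⨅ k : ℕ, (nsmulAddMonoidHom (α := G) (p ^ k)).range

theorem mem_powDivisible {G : Type*} [AddCommGroup G] {p : ℕ} {x : G} :
    x ∈ powDivisible G p ↔ ∀ k : ℕ, ∃ y, p ^ k • y = x := by
  simp [powDivisible, AddSubgroup.mem_iInf]

theorem map_mem_powDivisible {G K : Type*} [AddCommGroup G] [AddCommGroup K] (f : G →+ K) {p : ℕ}
    {x : G} (hx : x ∈ powDivisible G p) : f x ∈ powDivisible K p := by
  rw [mem_powDivisible] at hx ⊢
  intro k
  obtain ⟨y, rfl⟩ := hx k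
  exact ⟨f y, (map_nsmul f _ y).symm⟩

theorem exists_nsmul_of_mem_powDivisible {G : Type*} [AddCommGroup G] {p : ℕ} {x : G}
    (hx : x ∈ powDivisible G p) : ∃ y, p • y = x := by
  simpa using mem_powDivisible.1 hx 1

theorem exists_nsmul_iff_of_sub_mem {G : Type*} [AddCommGroup G] {p : ℕ} {x y : G}
    (h : x - y ∈ powDivisible G p) (k : ℕ) : (∃ z, p ^ k • z = x) ↔ ∃ z, p ^ k • z = y := by
  obtain ⟨w, hw⟩ := mem_powDivisible.1 h k
  constructor
  · rintro ⟨z, rfl⟩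
    exact ⟨z - w, by rw [nsmul_sub, hw]; abel⟩
  · rintro ⟨z, rfl⟩
    exact ⟨z + w, by rw [nsmul_add, hw]; abel⟩

theorem exists_nsmul_iff_of_sub_mem' {G : Type*} [AddCommGroup G] {p : ℕ} {x y : G}
    (h : x - y ∈ powDivisible G p) : (∃ z, p • z = x) ↔ ∃ z, p • z = y := by
  simpa using exists_nsmul_iff_of_sub_mem h 1

/-- The intersection of all `powDivisible G p` is a divisible subgroup: roots are unique without
torsion, so the `n`-th root of `x` is `p ^ k` times the `n * p ^ k`-th root and stays in the
intersection. -/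
theorem eq_zero_of_forall_mem_powDivisible {G : Type*} [AddCommGroup G] [IsAddTorsionFree G]
    (hred : IsReducedGroup G) {x : G} (hx : ∀ p : ℕ, p.Prime → x ∈ powDivisible G p) : x = 0 := by
  have key : ∀ x ∈ ⨅ p : Nat.Primes, powDivisible G p, ∀ n : ℕ, n ≠ 0 → ∃ y, n • y = x := by
    intro x hx n hn
    rw [AddSubgroup.mem_iInf] at hx
    exact exists_nsmul_of_primePow x n hn fun p k hp _ => mem_powDivisible.1 (hx ⟨p, hp⟩) k
  have hD := hred (⨅ p : Nat.Primes, powDivisible G p) <| by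
    intro n hn x hx
    obtain ⟨y, hy⟩ := key x hx n hn
    refine ⟨y, ?_, hy⟩
    rw [AddSubgroup.mem_iInf]
    refine fun p => mem_powDivisible.2 fun k => ?_
    obtain ⟨z, hz⟩ := key x hx (n * p ^ k) (mul_ne_zero hn (pow_ne_zero _ p.2.ne_zero))
    refine ⟨z, nsmul_right_injective hn ?_⟩
    simp only [hy, ← hz, mul_smul]
  have : x ∈ ⨅ p : Nat.Primes, powDivisible G p :=
    AddSubgroup.mem_iInf.2 fun p => hx p p.2
  rwa [hD, AddSubgroup.mem_bot] at this

/-! ### Gluing maps by algebraic compactness -/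

theorem exists_retraction {G H : Type*} [AddCommGroup G] [AddCommGroup H] (i : G →+ H)
    (hi : Function.Injective i) (h : IsDirectSummandOf i.range ⊤) :
    ∃ π : H →+ G, ∀ g, π (i g) = g := by
  obtain ⟨B, hinf, hsup⟩ := h
  have hex : ∀ z : H, ∃ g : G, z - i g ∈ B := by
    intro z
    have hz : z ∈ i.range ⊔ B := hsup ▸ AddSubgroup.mem_top z
    obtain ⟨_, ⟨g, rfl⟩, b, hb, rfl⟩ := AddSubgroup.mem_sup.1 hz
    exact ⟨g, by simpa using hb⟩
  have huniq : ∀ (z : H) (g g' : G), z - i g ∈ B → z - i g' ∈ B → g = g' := by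
    intro z g g' h h'
    have h0 : i (g' - g) ∈ i.range ⊓ B :=
      ⟨⟨_, rfl⟩, by simpa [map_sub] using B.sub_mem h h'⟩
    rw [hinf, AddSubgroup.mem_bot, map_eq_zero_iff i hi, sub_eq_zero] at h0
    exact h0.symm
  choose r hr using hex
  refine ⟨AddMonoidHom.mk' r fun x y => huniq (x + y) _ _ (hr _) ?_, fun g => ?_⟩
  · have := B.add_mem (hr x) (hr y)
    rw [map_add]
    convert this using 1
    abel
  · exact huniq (i g) _ _ (hr _) (by simp [B.zero_mem])

instance (p : Nat.Primes) : Fact (p : ℕ).Prime := ⟨p.2⟩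

/-- In a reduced torsion-free algebraically compact group, maps `j p : G → H p` that reflect
divisibility by powers of `p` admit a common left inverse modulo the `p`-divisible parts. -/
theorem exists_hom_of_reflects {G : Type u} [AddCommGroup G] [IsAddTorsionFree G]
    (hred : IsReducedGroup G) (hac : IsAlgebraicallyCompact G)
    {H : Nat.Primes → Type u} [∀ p, AddCommGroup (H p)] (j : ∀ p, G →+ H p)
    (hj : ∀ (p : Nat.Primes) (g : G) (k : ℕ) (h : H p), (p : ℕ) ^ k • h = j p g →
      ∃ g', (p : ℕ) ^ k • g' = g) :
    ∃ ρ : (∀ p, H p) →+ G, ∀ p h g, h p = j p g → ρ h - g ∈ powDivisible G p := by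
  -- `G` is embedded in the product of all `H p / p ^ k H p`. Reflection of divisibility makes the
  -- embedding pure, and `ρ` comes from the resulting retraction.
  let N (s : Nat.Primes × ℕ) : AddSubgroup (H s.1) :=
    (nsmulAddMonoidHom (α := H s.1) ((s.1 : ℕ) ^ s.2)).range
  let q : (∀ p, H p) →+ ∀ s : Nat.Primes × ℕ, H s.1 ⧸ N s :=
    AddMonoidHom.mk' (fun h s => (h s.1 : H s.1 ⧸ N s)) fun _ _ => rfl
  let d : G →+ ∀ p, H p := AddMonoidHom.mk' (fun g p => j p g) fun x y => by ext p; simp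
  let i := q.comp d
  have hmk : ∀ (p : Nat.Primes) (k : ℕ) (g : G) (z : H p ⧸ N (p, k)) (n : ℕ), (p : ℕ) ^ k ∣ n →
      n • z = (j p g : H p ⧸ N (p, k)) → ∃ g', (p : ℕ) ^ k • g' = g := by
    rintro p k g z n ⟨m, rfl⟩ hz
    obtain ⟨z, rfl⟩ := QuotientAddGroup.mk_surjective z
    rw [← QuotientAddGroup.mk_nsmul, QuotientAddGroup.eq] at hz
    obtain ⟨w, hw⟩ := hz
    refine hj p g k (m • z + w) ?_
    have hw' : (p : ℕ) ^ k • w = -(((p : ℕ) ^ k * m) • z) + j p g := hw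
    rw [nsmul_add, hw', mul_smul]
    abel
  have hinj : Function.Injective i := by
    rw [injective_iff_map_eq_zero]
    intro g hg
    refine eq_zero_of_forall_mem_powDivisible hred fun p hp => mem_powDivisible.2 fun k => ?_
    refine hmk ⟨p, hp⟩ k g 0 (p ^ k) dvd_rfl ?_
    rw [smul_zero]
    exact (congrFun hg (⟨p, hp⟩, k)).symm
  have hpure : IsPureSubgroup i.range := by
    rintro n h ⟨g, hg⟩
    rcases eq_or_ne n 0 with rfl | hn
    · exact ⟨0, zero_mem _, by simp⟩
    obtain ⟨y, hy⟩ := exists_nsmul_of_primePow g n hn fun p k hp hd =>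
      hmk ⟨p, hp⟩ k g (h (⟨p, hp⟩, k)) n hd (congrFun hg (⟨p, hp⟩, k)).symm
    exact ⟨i y, ⟨y, rfl⟩, by rw [← map_nsmul, hy, hg]⟩
  obtain ⟨π, hπ⟩ := exists_retraction i hinj (hac _ i hinj hpure)
  refine ⟨π.comp q, fun p h g hg => ?_⟩
  have hsub : π.comp q h - g = π (q h - i g) := by rw [map_sub, hπ]; rfl
  rw [hsub]
  apply map_mem_powDivisible
  rw [mem_powDivisible]
  intro m
  -- At the prime `p` both components agree. At `r ≠ p` the quotient is killed by `r ^ k`, so `p`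
  -- acts invertibly on it.
  have hcomp : ∀ s : Nat.Primes × ℕ, ∃ y, (p : ℕ) ^ m • y = (q h - i g) s := by
    rintro ⟨r, k⟩
    by_cases hr : r = p
    · subst hr
      refine ⟨0, ?_⟩
      change _ = ((h r : H r ⧸ N (r, k)) - (j r g : H r ⧸ N (r, k)))
      rw [hg, sub_self, smul_zero]
    · generalize (q h - i g) (r, k) = z
      have hz : (r : ℕ) ^ k • z = 0 := by
        obtain ⟨z, rfl⟩ := QuotientAddGroup.mk_surjective z
        rw [← QuotientAddGroup.mk_nsmul, QuotientAddGroup.eq_zero_iff]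
        exact ⟨z, rfl⟩
      have hcop : ((p : ℕ) ^ m).Coprime ((r : ℕ) ^ k) :=
        Nat.Coprime.pow _ _ ((Nat.coprime_primes p.2 r.2).2 fun h => hr (Subtype.ext h.symm))
      have hbez : (1 : ℤ) = ((p : ℕ) ^ m : ℕ) * Nat.gcdA (p ^ m) (r ^ k)
          + ((r : ℕ) ^ k : ℕ) * Nat.gcdB (p ^ m) (r ^ k) := by
        rw [← Nat.gcd_eq_gcd_ab, hcop.gcd_eq_one, Nat.cast_one]
      refine ⟨Nat.gcdA (p ^ m) (r ^ k) • z, ?_⟩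
      conv_rhs => rw [← one_smul ℤ z, hbez, add_smul, mul_comm ((r ^ k : ℕ) : ℤ), mul_smul,
        mul_smul, natCast_zsmul _ (r ^ k), hz, smul_zero, add_zero, natCast_zsmul]
  choose y hy using hcomp
  exact ⟨y, funext hy⟩

/-- Simultaneous extension, up to elements divisible by all powers of `p`, of the maps
`f p : F p → G` along maps `u p : F p → X p` that reflect divisibility by powers of `p`. -/
theorem exists_hom_extending {G : Type u} [AddCommGroup G] [IsAddTorsionFree G]
    (hred : IsReducedGroup G) (hac : IsAlgebraicallyCompact G)
    {F : Nat.Primes → Type*} {X : Nat.Primes → Type u} [∀ p, AddCommGroup (F p)]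
    [∀ p, AddCommGroup (X p)] (u : ∀ p, F p →+ X p) (f : ∀ p, F p →+ G)
    (hu : ∀ (p : Nat.Primes) (y : F p) (k : ℕ) (x : X p), (p : ℕ) ^ k • x = u p y →
      ∃ y', (p : ℕ) ^ k • y' = y) :
    ∃ ρ : (∀ p, X p) →+ G, ∀ p x y, x p = u p y → ρ x - f p y ∈ powDivisible G p := by
  -- The pushout of `f p` and `u p`: reflection by `u p` passes to the map from `G` into the
  -- pushout.
  let N (p : Nat.Primes) : AddSubgroup (G × X p) := ((f p).prod (-u p)).range
  let j (p : Nat.Primes) : G →+ (G × X p) ⧸ N p :=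
    (QuotientAddGroup.mk' (N p)).comp (AddMonoidHom.inl G (X p))
  obtain ⟨ρ, hρ⟩ := exists_hom_of_reflects hred hac j <| by
    intro p g k h hh
    obtain ⟨⟨g', x⟩, rfl⟩ := QuotientAddGroup.mk_surjective h
    have hh' : (((p : ℕ) ^ k • (g', x) : G × X p) : (G × X p) ⧸ N p) = ((g, 0) : G × X p) := hh
    rw [QuotientAddGroup.eq] at hh'
    obtain ⟨y, hy⟩ := hh'
    have h1 : f p y = -((p : ℕ) ^ k • g') + g := congrArg Prod.fst hy
    have h2 : -u p y = -((p : ℕ) ^ k • x) + 0 := congrArg Prod.snd hy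
    obtain ⟨y', rfl⟩ := hu p y k x (by rw [add_zero] at h2; exact (neg_injective h2).symm)
    refine ⟨g' + f p y', ?_⟩
    rw [nsmul_add, ← map_nsmul, h1]
    abel
  let t : (∀ p, X p) →+ ∀ p, (G × X p) ⧸ N p :=
    AddMonoidHom.mk' (fun x p => ((0, x p) : G × X p)) fun x y => funext fun p =>
      map_add ((QuotientAddGroup.mk' (N p)).comp (AddMonoidHom.inr G (X p))) (x p) (y p)
  refine ⟨ρ.comp t, fun p x y hxy => hρ p (t x) (f p y) ?_⟩
  change (((0, x p) : G × X p) : (G × X p) ⧸ N p) = ((f p y, 0) : G × X p)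
  rw [QuotientAddGroup.eq]
  exact ⟨y, by simp [hxy]⟩

theorem exists_nsmul_of_reflects {F X : Type*} [AddCommGroup F] [AddCommGroup X]
    [IsAddTorsionFree X] (u : F →+ X) {p : ℕ} (hp : p ≠ 0)
    (hu : ∀ (y : F) (x : X), p • x = u y → ∃ y', p • y' = y) (k : ℕ) :
    ∀ (y : F) (x : X), p ^ k • x = u y → ∃ y', p ^ k • y' = y := by
  induction k with
  | zero => exact fun y _ _ => ⟨y, by simp⟩
  | succ k ih =>
    intro y x h
    rw [pow_succ', mul_smul] at h
    obtain ⟨y', rfl⟩ := hu y _ h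
    rw [map_nsmul] at h
    obtain ⟨z, rfl⟩ := ih y' x (nsmul_right_injective hp h)
    exact ⟨z, by rw [pow_succ', mul_smul]⟩

theorem injective_of_reflects {G X : Type*} [AddCommGroup G] [AddCommGroup X] [IsAddTorsionFree G]
    [IsAddTorsionFree X] (hred : IsReducedGroup G) (φ : G →+ X)
    (hφ : ∀ p : ℕ, p.Prime → ∀ (y : G) (x : X), p • x = φ y → ∃ y', p • y' = y) :
    Function.Injective φ := by
  rw [injective_iff_map_eq_zero]
  refine fun g hg => eq_zero_of_forall_mem_powDivisible hred fun p hp => ?_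
  rw [mem_powDivisible]
  exact fun k => exists_nsmul_of_reflects φ hp.ne_zero (hφ p hp) k g 0 (by rw [hg, smul_zero])

theorem mem_powDivisible_of_nsmul_mem {G : Type*} [AddCommGroup G] [IsAddTorsionFree G] {p : ℕ}
    (hp : p ≠ 0) {k : ℕ} {x : G} (hx : p ^ k • x ∈ powDivisible G p) : x ∈ powDivisible G p := by
  rw [mem_powDivisible] at hx ⊢
  intro m
  obtain ⟨y, hy⟩ := hx (k + m)
  rw [pow_add, mul_smul] at hy
  exact ⟨y, nsmul_right_injective (pow_ne_zero k hp) hy⟩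

/-! ### Consequences of relative co-Hopficity -/

/-- In a torsion-free relatively co-Hopfian group, every injective endomorphism has torsion
cokernel. -/
theorem IsRelativelyCoHopfian.exists_nsmul_eq {G : Type*} [AddCommGroup G] [IsAddTorsionFree G]
    (h : IsRelativelyCoHopfian G) (φ : G →+ G) (hφ : Function.Injective φ) (x : G) :
    ∃ n : ℕ, n ≠ 0 ∧ ∃ y, φ y = n • x := by
  by_contra! hcon
  have hz : ∀ m : ℤ, m • x ∈ φ.range → m = 0 := by
    rintro m ⟨y, hy⟩
    by_contra hm
    rcases Int.natAbs_eq m with he | he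
    · refine hcon m.natAbs (Int.natAbs_ne_zero.2 hm) y ?_
      rw [hy, ← natCast_zsmul, ← he]
    · refine hcon m.natAbs (Int.natAbs_ne_zero.2 hm) (-y) ?_
      rw [map_neg, hy, ← natCast_zsmul, ← neg_smul]
      congr 1
      lia
  -- The factor 2 keeps `x` itself outside `φ.range ⊔ B`, so that this subgroup is proper.
  let B := AddSubgroup.zmultiples ((2 : ℤ) • x)
  refine (h (φ.range ⊔ B) φ.range ?_ ⟨B, ?_, rfl⟩ ?_).false (AddMonoidHom.ofInjective hφ)
  · intro htop
    have hx : x ∈ φ.range ⊔ B := htop ▸ AddSubgroup.mem_top x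
    obtain ⟨a, ha, b, hb, hab⟩ := AddSubgroup.mem_sup.1 hx
    obtain ⟨k, rfl⟩ := AddSubgroup.mem_zmultiples_iff.1 hb
    have : (1 - 2 * k) • x ∈ φ.range := by
      convert ha using 1
      rw [eq_sub_of_add_eq hab]
      module
    have := hz _ this
    lia
  · rw [eq_bot_iff]
    rintro y ⟨hy, hb⟩
    obtain ⟨k, rfl⟩ := AddSubgroup.mem_zmultiples_iff.1 hb
    rw [smul_smul] at hy
    have hk := hz _ hy
    have : k = 0 := by lia
    simp [this]
  · intro heq
    have hmem : (2 : ℤ) • x ∈ φ.range := by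
      rw [heq]
      exact AddSubgroup.mem_sup_right (AddSubgroup.mem_zmultiples _)
    exact absurd (hz _ hmem) two_ne_zero

theorem exists_basis_mod_of_surjective {G : Type*} [AddCommGroup G] {V : Type u} [AddCommGroup V]
    (p : ℕ) [Fact p.Prime] [Module (ZMod p) V] (π : G →+ V) (hπ : Function.Surjective π)
    (hker : ∀ g, π g = 0 ↔ ∃ z, p • z = g) :
    ∃ (B : Type u) (b : B → G),
      (∀ (y : B →₀ ℤ) (z : G), p • z = Finsupp.linearCombination ℤ b y → ∀ i, (p : ℤ) ∣ y i) ∧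
      ∀ g, ∃ (y : B →₀ ℤ) (z : G), g = Finsupp.linearCombination ℤ b y + p • z := by
  let e := Module.Basis.ofVectorSpace (ZMod p) V
  choose b hb using fun i => hπ (e i)
  let c : (Module.Basis.ofVectorSpaceIndex (ZMod p) V →₀ ℤ) →+ (_ →₀ ZMod p) :=
    Finsupp.mapRange.addMonoidHom (Int.castAddHom (ZMod p))
  have hcast : ∀ y, π (Finsupp.linearCombination ℤ b y) =
      Finsupp.linearCombination (ZMod p) e (c y) := by
    intro y
    refine DFunLike.congr_fun (f := π.comp (Finsupp.linearCombination ℤ b).toAddMonoidHom)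
      (g := (Finsupp.linearCombination (ZMod p) e).toAddMonoidHom.comp c) ?_ y
    ext i
    simp [hb, c]
  refine ⟨_, b, fun y z hz i => ?_, fun g => ?_⟩
  · have h0 := (hker _).2 ⟨z, hz⟩
    rw [hcast] at h0
    have := DFunLike.congr_fun (linearIndependent_iff.1 e.linearIndependent _ h0) i
    simpa [c, ZMod.intCast_zmod_eq_zero_iff_dvd] using this
  · let y := (e.repr (π g)).mapRange (fun a : ZMod p => (a.val : ℤ)) (by simp)
    have hy : c y = e.repr (π g) := by
      ext i
      simp [y, c]
    obtain ⟨z, hz⟩ := (hker (g - Finsupp.linearCombination ℤ b y)).1 (by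
      rw [map_sub, hcast, hy, e.linearCombination_repr, sub_self])
    exact ⟨y, z, by rw [hz]; abel⟩

/-- Every group has a family of elements which is a basis modulo the prime `p`. -/
theorem exists_basis_mod (G : Type u) [AddCommGroup G] (p : ℕ) [Fact p.Prime] :
    ∃ (B : Type u) (b : B → G),
      (∀ (y : B →₀ ℤ) (z : G), p • z = Finsupp.linearCombination ℤ b y → ∀ i, (p : ℤ) ∣ y i) ∧
      ∀ g, ∃ (y : B →₀ ℤ) (z : G), g = Finsupp.linearCombination ℤ b y + p • z := by
  let _ : Module (ZMod p) (G ⧸ (nsmulAddMonoidHom (α := G) p).range) :=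
    QuotientAddGroup.zmodModule fun x => ⟨x, rfl⟩
  exact exists_basis_mod_of_surjective p
    (QuotientAddGroup.mk' (nsmulAddMonoidHom (α := G) p).range)
    (QuotientAddGroup.mk'_surjective _) fun g => QuotientAddGroup.eq_zero_iff g

theorem exists_nsmul_eq_of_forall_dvd {B : Type*} {n : ℕ} {y : B →₀ ℤ}
    (h : ∀ i, (n : ℤ) ∣ y i) : ∃ y', n • y' = y := by
  refine ⟨y.mapRange (· / (n : ℤ)) (by simp), ?_⟩
  ext i
  simp [Int.mul_ediv_cancel' (h i)]

/-- Let `φ` act as `p` at each prime `p`, and let `ρ x` be non-divisible by `p` at each `p ∈ S`. A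
multiple `n • ρ x` in the image of `φ` is divisible by every `p`, so every `p ∈ S` divides `n`;
hence `S` must be finite. -/
theorem finite_setOf_not_divisible {G : Type u} [AddCommGroup G] [IsAddTorsionFree G]
    (hred : IsReducedGroup G) (hac : IsAlgebraicallyCompact G) (hG : IsRelativelyCoHopfian G) :
    {p : Nat.Primes | ∃ g : G, ∀ z, (p : ℕ) • z ≠ g}.Finite := by
  by_contra hS
  set S := {p : Nat.Primes | ∃ g : G, ∀ z, (p : ℕ) • z ≠ g}
  have hx : ∀ p : Nat.Primes, ∃ g : G, p ∈ S → ∀ z, (p : ℕ) • z ≠ g := fun p => by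
    by_cases hp : p ∈ S
    · exact hp.imp fun g hg _ => hg
    · exact ⟨0, fun h => absurd h hp⟩
  choose x hx using hx
  obtain ⟨ρ, hρ⟩ := exists_hom_extending hred hac (F := fun _ => G) (X := fun _ => G)
    (fun _ => AddMonoidHom.id G) (fun _ => AddMonoidHom.id G) fun p y k z hz => ⟨z, hz⟩
  let φ : G →+ G := ρ.comp <| AddMonoidHom.mk' (fun g (p : Nat.Primes) => (p : ℕ) • g)
    fun g g' => by ext p; simp
  have hφ : ∀ (p : Nat.Primes) g, φ g - (p : ℕ) • g ∈ powDivisible G p :=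
    fun p g => hρ p _ ((p : ℕ) • g) rfl
  have hinj : Function.Injective φ := by
    rw [injective_iff_map_eq_zero]
    refine fun g hg => eq_zero_of_forall_mem_powDivisible hred fun p hp => ?_
    have := hφ ⟨p, hp⟩ g
    rw [hg, zero_sub, neg_mem_iff] at this
    exact mem_powDivisible_of_nsmul_mem hp.ne_zero (k := 1) (by simpa using this)
  obtain ⟨n, hn, y, hy⟩ := hG.exists_nsmul_eq φ hinj (ρ x)
  have hfin : {p : Nat.Primes | (p : ℕ) ∣ n}.Finite :=
    Set.Finite.of_finite_image
      ((n.divisors.finite_toSet).subset (by rintro _ ⟨p, hp, rfl⟩; simpa [hn] using hp))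
      Subtype.val_injective.injOn
  obtain ⟨p, hpS, hpn⟩ := Set.Infinite.exists_notMem_finite hS hfin
  obtain ⟨w, hw⟩ := (exists_nsmul_iff_of_sub_mem' (hφ p y)).2 ⟨y, rfl⟩
  have hcop : n.Coprime p := ((Nat.Prime.coprime_iff_not_dvd p.2).2 hpn).symm
  obtain ⟨v, hv⟩ := exists_nsmul_of_coprime hcop hy.symm hw
  rw [hy, mul_smul] at hv
  obtain ⟨z, hz⟩ := (exists_nsmul_iff_of_sub_mem' (hρ p x (x p) rfl)).1
    ⟨v, nsmul_right_injective hn hv⟩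
  exact hx p hpS z hz

theorem exists_injective_not_surjective (B : Type*) :
    ∃ s : B → B, Function.Injective s ∧ (Infinite B → ∃ b, b ∉ Set.range s) := by
  cases finite_or_infinite B with
  | inl h => exact ⟨id, Function.injective_id, fun h' => (not_finite B).elim⟩
  | inr h =>
    obtain ⟨b⟩ := (inferInstance : Nonempty B)
    have hcard : Cardinal.mk B = Cardinal.mk ({b}ᶜ : Set B) :=
      (Cardinal.mk_compl_of_infinite {b} (by simp [Cardinal.one_lt_aleph0.trans_le
        (Cardinal.aleph0_le_mk B)])).symm
    obtain ⟨e⟩ := Cardinal.eq.1 hcard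
    refine ⟨fun x => (e x : B), Subtype.val_injective.comp e.injective, fun _ => ⟨b, ?_⟩⟩
    rintro ⟨x, hx⟩
    exact (e x).2 hx

/-- The glued endomorphism `φ` shifts the basis at each prime by an injection `s p`, which misses an
index if `B p` is infinite. It reflects divisibility, hence is injective, yet no nonzero multiple of
the missed basis element lies in its image. -/
theorem finite_basis_mod {G : Type u} [AddCommGroup G] [IsAddTorsionFree G]
    (hred : IsReducedGroup G) (hac : IsAlgebraicallyCompact G) (hG : IsRelativelyCoHopfian G)
    {B : Nat.Primes → Type*} (b : ∀ p, B p → G)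
    (hind : ∀ (p : Nat.Primes) (y : B p →₀ ℤ) (z : G),
      (p : ℕ) • z = Finsupp.linearCombination ℤ (b p) y → ∀ i, ((p : ℕ) : ℤ) ∣ y i)
    (hspan : ∀ (p : Nat.Primes) (g : G),
      ∃ (y : B p →₀ ℤ) (z : G), g = Finsupp.linearCombination ℤ (b p) y + (p : ℕ) • z)
    (p : Nat.Primes) : Finite (B p) := by
  by_contra hfin
  rw [not_finite_iff_infinite] at hfin
  choose s hs hs' using fun p => exists_injective_not_surjective (B p)
  let u (p : Nat.Primes) : (B p →₀ ℤ) →+ G := (Finsupp.linearCombination ℤ (b p)).toAddMonoidHom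
  let σ (p : Nat.Primes) : (B p →₀ ℤ) →+ (B p →₀ ℤ) := Finsupp.mapDomain.addMonoidHom (s p)
  have hu : ∀ (p : Nat.Primes) (y : B p →₀ ℤ) (z : G), (p : ℕ) • z = u p y →
      ∃ y', (p : ℕ) • y' = y :=
    fun p y z hz => exists_nsmul_eq_of_forall_dvd (hind p y z hz)
  obtain ⟨ρ, hρ⟩ := exists_hom_extending hred hac (X := fun _ => G) u
    (fun p => (u p).comp (σ p))
    fun p y k z hz => exists_nsmul_of_reflects (u p) p.2.ne_zero (hu p) k y z hz
  let φ : G →+ G := ρ.comp <| AddMonoidHom.mk' (fun g _ => g) fun g g' => rfl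
  have hφ : ∀ (p : Nat.Primes) y, φ (u p y) - u p (σ p y) ∈ powDivisible G p :=
    fun p y => hρ p _ y rfl
  have hrefl : ∀ (p : Nat.Primes) (g z : G), (p : ℕ) • z = φ g → ∃ g', (p : ℕ) • g' = g := by
    intro p g z hz
    obtain ⟨y, w, rfl⟩ := hspan p g
    have h1 : (p : ℕ) • (z - φ w) = φ (u p y) := by
      rw [nsmul_sub, hz, map_add, map_nsmul]
      exact add_sub_cancel_right _ _
    obtain ⟨v, hv⟩ := (exists_nsmul_iff_of_sub_mem' (hφ p y)).1 ⟨_, h1⟩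
    have hdvd := hind p _ _ hv
    obtain ⟨y', rfl⟩ := exists_nsmul_eq_of_forall_dvd (n := (p : ℕ)) (y := y) fun i => by
      have := hdvd (s p i)
      rwa [show σ p y (s p i) = y i from Finsupp.mapDomain_apply (hs p) y i] at this
    exact ⟨u p y' + w, by rw [nsmul_add, ← map_nsmul]; rfl⟩
  have hinj := injective_of_reflects hred φ fun p hp => hrefl ⟨p, hp⟩
  obtain ⟨i, hi⟩ := hs' p hfin
  obtain ⟨n, hn, g, hg⟩ := hG.exists_nsmul_eq φ hinj (b p i)
  -- Since `φ` reflects divisibility, the power of `p` in `n` can be cancelled, leaving `m` prime to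
  -- `p`; the coefficient at the missed index `i` then forces `p ∣ m`.
  obtain ⟨k, m, hm, rfl⟩ := Nat.exists_eq_pow_mul_and_not_dvd hn p p.2.ne_one
  rw [mul_smul] at hg
  obtain ⟨g, rfl⟩ := exists_nsmul_of_reflects φ p.2.ne_zero (hrefl p) k g _ hg.symm
  rw [map_nsmul] at hg
  replace hg := nsmul_right_injective (pow_ne_zero k p.2.ne_zero) hg
  obtain ⟨y, w, rfl⟩ := hspan p g
  have h1 : (p : ℕ) • (-φ w) = φ (u p y) - m • b p i := by
    replace hg : φ (u p y + (p : ℕ) • w) = m • b p i := hg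
    rw [← hg, map_add, map_nsmul, smul_neg]
    change _ = φ (u p y) - (φ (u p y) + _)
    abel
  obtain ⟨v, hv⟩ := (exists_nsmul_iff_of_sub_mem' (x := φ (u p y) - m • b p i)
    (y := u p (σ p y) - m • b p i) (by simpa using hφ p y)).1 ⟨_, h1⟩
  have h2 := hind p (σ p y - m • Finsupp.single i 1) v (by
    rw [hv, map_sub, map_nsmul, Finsupp.linearCombination_single, one_smul]; rfl) i
  have h3 : σ p y i = 0 := Finsupp.mapDomain_of_notMem_range y i hi
  rw [Finsupp.sub_apply, h3] at h2
  simp [Int.natCast_dvd_natCast] at h2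
  exact hm h2

/-! ### Products of `p`-adic integers and the structure of `G` -/

theorem padicInt_exists_limit (p : ℕ) [Fact p.Prime] (s : ℕ → ℤ_[p])
    (hs : ∀ k, ∃ w, s (k + 1) = s k + p ^ k • w) : ∃ L, ∀ k, ∃ w, L = s k + p ^ k • w := by
  have hmem : ∀ k (x : ℤ_[p]), x ∈ (IsLocalRing.maximalIdeal ℤ_[p] ^ k • ⊤ : Submodule ℤ_[p] ℤ_[p])
      ↔ ∃ w, x = p ^ k • w := by
    intro k x
    rw [PadicInt.maximalIdeal_eq_span_p, Ideal.span_singleton_pow, smul_eq_mul, Ideal.mul_top,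
      Ideal.mem_span_singleton]
    simp [Dvd.dvd]
  have hmono : ∀ m d, ∃ w, s (m + d) = s m + p ^ m • w := by
    intro m d
    induction d with
    | zero => exact ⟨0, by simp⟩
    | succ d ih =>
      obtain ⟨w, hw⟩ := ih
      obtain ⟨w', hw'⟩ := hs (m + d)
      exact ⟨w + p ^ d • w', by rw [← add_assoc, hw', hw, pow_add, mul_smul, smul_add, add_assoc]⟩
  obtain ⟨L, hL⟩ := IsPrecomplete.prec
    (inferInstance : IsPrecomplete (IsLocalRing.maximalIdeal ℤ_[p]) ℤ_[p]) (f := s) <| by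
      intro m n hmn
      obtain ⟨d, rfl⟩ := Nat.exists_eq_add_of_le hmn
      obtain ⟨w, hw⟩ := hmono m d
      rw [SModEq.sub_mem, hmem]
      exact ⟨-w, by rw [hw, smul_neg]; ring⟩
  refine ⟨L, fun k => ?_⟩
  obtain ⟨w, hw⟩ := (hmem k _).1 (SModEq.sub_mem.1 (hL k))
  exact ⟨-w, by rw [smul_neg, ← hw]; ring⟩

theorem padicInt_eq_zero_of_forall_pow (p : ℕ) [Fact p.Prime] (x : ℤ_[p])
    (hx : ∀ k : ℕ, ∃ w, p ^ k • w = x) : x = 0 := by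
  by_contra h0
  obtain ⟨n, hn⟩ := FiniteMultiplicity.of_not_isUnit (PadicInt.p_nonunit (p := p)) h0
  obtain ⟨w, rfl⟩ := hx (n + 1)
  exact hn ⟨w, by simp⟩

theorem padicInt_exists_eq_intCast_add (p : ℕ) [Fact p.Prime] (x : ℤ_[p]) :
    ∃ (n : ℤ) (w : ℤ_[p]), x = n + p • w := by
  have h := PadicInt.sub_zmodRepr_mem x
  rw [PadicInt.maximalIdeal_eq_span_p, Ideal.mem_span_singleton] at h
  obtain ⟨w, hw⟩ := h
  exact ⟨x.zmodRepr, w, by rw [nsmul_eq_mul, ← hw]; push_cast; ring⟩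

/-- A reduced torsion-free algebraically compact group with finite `p`-ranks is a product of
free modules of finite rank over the rings of `p`-adic integers. -/
theorem nonempty_addEquiv_pi {G : Type u} [AddCommGroup G] [IsAddTorsionFree G]
    (hred : IsReducedGroup G) (hac : IsAlgebraicallyCompact G)
    {B : Nat.Primes → Type u} (b : ∀ p, B p → G) [∀ p, Finite (B p)]
    (hind : ∀ (p : Nat.Primes) (y : B p →₀ ℤ) (z : G),
      (p : ℕ) • z = Finsupp.linearCombination ℤ (b p) y → ∀ i, ((p : ℕ) : ℤ) ∣ y i)
    (hspan : ∀ (p : Nat.Primes) (g : G),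
      ∃ (y : B p →₀ ℤ) (z : G), g = Finsupp.linearCombination ℤ (b p) y + (p : ℕ) • z) :
    Nonempty (G ≃+ ∀ p : Nat.Primes, B p → ℤ_[p]) := by
  classical
  let X (p : Nat.Primes) : Type u := B p → ℤ_[p]
  let u (p : Nat.Primes) : (B p →₀ ℤ) →+ X p :=
    AddMonoidHom.mk' (fun y i => (y i : ℤ_[p])) fun y y' =>
      funext fun i => Int.cast_add (y i) (y' i)
  let f (p : Nat.Primes) : (B p →₀ ℤ) →+ G := (Finsupp.linearCombination ℤ (b p)).toAddMonoidHom
  obtain ⟨Θ, hΘ⟩ := exists_hom_extending hred hac (X := X) u f <| by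
    intro p y k x hx
    refine exists_nsmul_eq_of_forall_dvd fun i => ?_
    rw [Nat.cast_pow, ← PadicInt.pow_p_dvd_int_iff]
    exact ⟨x i, by rw [← Nat.cast_pow, ← nsmul_eq_mul]; exact (congrFun hx i).symm⟩
  have hdigit : ∀ (p : Nat.Primes) (x : X p), ∃ y w, x = u p y + (p : ℕ) • w := by
    intro p x
    choose n w hw using fun i => padicInt_exists_eq_intCast_add p (x i)
    refine ⟨Finsupp.equivFunOnFinite.symm n, w, funext fun i => ?_⟩
    exact hw i
  have hzero : ∀ (p : Nat.Primes) (a : ∀ p, X p), a p = 0 → Θ a ∈ powDivisible G p := by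
    intro p a ha
    simpa using hΘ p a 0 (by rw [ha, map_zero])
  let θ (p : Nat.Primes) : X p →+ G := Θ.comp (AddMonoidHom.single X p)
  have hθ : ∀ (p : Nat.Primes) (y : B p →₀ ℤ), θ p (u p y) - f p y ∈ powDivisible G p :=
    fun p y => hΘ p _ y (Pi.single_eq_same p _)
  have hsingle : ∀ (p : Nat.Primes) (a : ∀ p, X p), Θ a - θ p (a p) ∈
      powDivisible G p := by
    intro p a
    change Θ a - Θ (Pi.single p (a p)) ∈ _
    rw [← map_sub]
    exact hzero p _ (by simp)
  have hdvd : ∀ (p : Nat.Primes) (x : X p), θ p x ∈ powDivisible G p →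
      ∃ w, (p : ℕ) • w = x ∧ θ p w ∈ powDivisible G p := by
    intro p x hx
    obtain ⟨y, w, rfl⟩ := hdigit p x
    have h1 := hθ p y
    have h2 : f p y + (p : ℕ) • θ p w ∈ powDivisible G p := by
      convert sub_mem hx h1 using 1
      rw [map_add, map_nsmul]
      abel
    obtain ⟨z, hz⟩ := exists_nsmul_of_mem_powDivisible h2
    obtain ⟨y', rfl⟩ := exists_nsmul_eq_of_forall_dvd (hind p y (z - θ p w) (by
      rw [nsmul_sub, hz]; exact add_sub_cancel_right _ _))
    rw [map_nsmul, ← nsmul_add, map_nsmul] at hx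
    refine ⟨u p y' + w, by rw [nsmul_add, map_nsmul], ?_⟩
    exact mem_powDivisible_of_nsmul_mem p.2.ne_zero (k := 1) (by rwa [pow_one])
  have hpow : ∀ (p : Nat.Primes) (k : ℕ) (x : X p), θ p x ∈ powDivisible G p →
      ∃ w, (p : ℕ) ^ k • w = x := by
    intro p k
    induction k with
    | zero => exact fun x _ => ⟨x, by simp⟩
    | succ k ih =>
      intro x hx
      obtain ⟨w, rfl, hw⟩ := hdvd p x hx
      obtain ⟨v, rfl⟩ := ih w hw
      exact ⟨v, by rw [pow_succ', mul_smul]⟩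
  refine ⟨(AddEquiv.ofBijective Θ ⟨?_, ?_⟩).symm⟩
  · rw [injective_iff_map_eq_zero]
    intro a ha
    funext p i
    refine padicInt_eq_zero_of_forall_pow p _ fun k => ?_
    have h := hsingle p a
    rw [ha, zero_sub, neg_mem_iff] at h
    obtain ⟨w, hw⟩ := hpow p k _ h
    exact ⟨w i, congrFun hw i⟩
  · intro g
    have hloc : ∀ p : Nat.Primes, ∃ x : X p, g - θ p x ∈ powDivisible G p := by
      intro p
      choose y z hz using hspan p
      -- The `p`-adic expansion of `g` in the basis: `r k` is the `k`-th remainder, `Y m` the sum of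
      -- the first `m` terms. Its coefficients converge in `ℤ_[p]`.
      let r : ℕ → G := fun k => z^[k] g
      let Y : ℕ → (B p →₀ ℤ) := fun m => ∑ k ∈ Finset.range m, (p : ℕ) ^ k • y (r k)
      have hY : ∀ m, g = f p (Y m) + (p : ℕ) ^ m • r m := by
        intro m
        induction m with
        | zero => simp [Y, r]
        | succ m ih =>
          have h1 : r m = f p (y (r m)) + (p : ℕ) • r (m + 1) := by
            simp only [r, Function.iterate_succ_apply']
            exact hz _
          calc g = f p (Y m) + (p : ℕ) ^ m • (f p (y (r m)) + (p : ℕ) • r (m + 1)) := by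
                rw [← h1]; exact ih
            _ = f p (Y (m + 1)) + (p : ℕ) ^ (m + 1) • r (m + 1) := by
                simp only [Y, Finset.sum_range_succ, map_add, map_nsmul, pow_succ, mul_smul,
                  nsmul_add, add_assoc]
      choose L hL using fun i => padicInt_exists_limit p (fun m => (Y m i : ℤ_[p])) fun k =>
        ⟨(y (r k) i : ℤ_[p]), by simp [Y, Finset.sum_range_succ]⟩
      refine ⟨L, mem_powDivisible.2 fun m => ?_⟩
      choose w hw using fun i => hL i m
      have hLw : L = u p (Y m) + (p : ℕ) ^ m • w := funext hw
      obtain ⟨v, hv⟩ := mem_powDivisible.1 (hθ p (Y m)) m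
      refine ⟨r m - v - θ p w, ?_⟩
      rw [hLw, map_add, map_nsmul, nsmul_sub, nsmul_sub, hv]
      conv_rhs => rw [hY m]
      abel
    choose x hx using hloc
    refine ⟨x, ?_⟩
    rw [eq_comm, ← sub_eq_zero]
    refine eq_zero_of_forall_mem_powDivisible hred fun p hp => ?_
    convert sub_mem (hx ⟨p, hp⟩) (hsingle ⟨p, hp⟩ x) using 1
    abel

theorem exists_addEquiv_directSum {G : Type u} [AddCommGroup G] [IsAddTorsionFree G]
    (hred : IsReducedGroup G) (hac : IsAlgebraicallyCompact G) (hG : IsRelativelyCoHopfian G) :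
    ∃ (n : ℕ) (p : Fin n → ℕ) (_ : ∀ i, Fact (p i).Prime),
      Nonempty (G ≃+ ⨁ i : Fin n, ℤ_[p i]) := by
  choose B b hind hspan using fun p : Nat.Primes => exists_basis_mod G p
  have hB := finite_basis_mod hred hac hG b hind hspan
  obtain ⟨e⟩ := nonempty_addEquiv_pi hred hac b hind hspan
  have hS := finite_setOf_not_divisible hred hac hG
  set S := {p : Nat.Primes | ∃ g : G, ∀ z, (p : ℕ) • z ≠ g}
  have hmem : ∀ x : Σ p, B p, x.1 ∈ S := by
    rintro ⟨p, i⟩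
    refine ⟨b p i, fun z hz => ?_⟩
    have := hind p (Finsupp.single i 1) z (by simpa using hz) i
    rw [Finsupp.single_eq_same] at this
    exact (Nat.prime_iff_prime_int.1 p.2).not_dvd_one this
  have hS' := hS.to_subtype
  have hI : Finite (Σ p, B p) := Finite.of_injective
    (fun x => (⟨⟨x.1, hmem x⟩, x.2⟩ : Σ p : S, B p)) (by
      rintro ⟨p, i⟩ ⟨q, j⟩ h
      simp only [Sigma.mk.injEq, Subtype.mk.injEq] at h
      obtain ⟨rfl, h⟩ := h
      rw [eq_of_heq h])
  obtain ⟨n, ⟨t⟩⟩ := Finite.exists_equiv_fin (Σ p, B p)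
  let c : (∀ p : Nat.Primes, B p → ℤ_[p]) ≃+ ∀ i : Fin n, ℤ_[((t.symm i).1 : ℕ)] :=
    { toFun := fun a i => a (t.symm i).1 (t.symm i).2
      invFun := fun a p j => (Equiv.piCongrLeft' (fun x : Σ p, B p => ℤ_[(x.1 : ℕ)]) t).symm a ⟨p, j⟩
      left_inv := fun a => by
        have := (Equiv.piCongrLeft' (fun x : Σ p, B p => ℤ_[(x.1 : ℕ)]) t).symm_apply_apply
          (fun x => a x.1 x.2)
        funext p j
        exact congrFun this ⟨p, j⟩
      right_inv := fun a =>
        (Equiv.piCongrLeft' (fun x : Σ p, B p => ℤ_[(x.1 : ℕ)]) t).apply_symm_apply a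
      map_add' := fun _ _ => rfl }
  exact ⟨n, fun i => (t.symm i).1, fun i => inferInstance,
    ⟨(e.trans c).trans (DirectSum.addEquivProd _).symm⟩⟩

/-! ### Converse: injective endomorphisms of finite products -/

theorem isUnit_padicInt_natCast {p r : ℕ} [hp : Fact p.Prime] (hr : r.Prime) (hpr : p ≠ r) :
    IsUnit (r : ℤ_[p]) := by
  by_contra h
  rw [PadicInt.not_isUnit_iff, ← Int.cast_natCast, PadicInt.norm_int_lt_one_iff_dvd,
    Int.natCast_dvd_natCast] at h
  exact hpr ((Nat.prime_dvd_prime_iff_eq hp.out hr).1 h)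

theorem padicInt_exists_pow_nsmul {p r : ℕ} [Fact p.Prime] (hr : r.Prime) (hpr : p ≠ r) (k : ℕ)
    (x : ℤ_[p]) : ∃ w, r ^ k • w = x := by
  obtain ⟨w, hw⟩ := ((isUnit_padicInt_natCast hr hpr).pow k).dvd (a := x)
  exact ⟨w, by rw [hw, nsmul_eq_mul, Nat.cast_pow]⟩

/-- Additive maps into powers of the `p`-adic integers are linear over the `p`-adic integers. -/
theorem map_padicInt_smul {p : ℕ} [Fact p.Prime] {M J : Type*} [AddCommGroup M] [Module ℤ_[p] M]
    (ψ : M →+ (J → ℤ_[p])) (a : ℤ_[p]) (x : M) : ψ (a • x) = a • ψ x := by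
  rw [← sub_eq_zero]
  funext j
  refine padicInt_eq_zero_of_forall_pow p _ fun k => ?_
  obtain ⟨w, hw⟩ := Ideal.mem_span_singleton.1 (PadicInt.appr_spec k a)
  have ha : a = (a.appr k : ℤ_[p]) + ((p ^ k : ℕ) : ℤ_[p]) * w := by
    rw [Nat.cast_pow, ← hw]
    ring
  refine ⟨ψ (w • x) j - w * ψ x j, ?_⟩
  have h1 : ψ (a • x) = a.appr k • ψ x + p ^ k • ψ (w • x) := by
    conv_lhs => rw [ha]
    rw [add_smul, mul_smul, Nat.cast_smul_eq_nsmul, Nat.cast_smul_eq_nsmul, map_add, map_nsmul,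
      map_nsmul]
  rw [h1]
  change p ^ k • (ψ (w • x) j - w * ψ x j) =
    a.appr k • ψ x j + p ^ k • ψ (w • x) j - a * ψ x j
  rw [nsmul_eq_mul, nsmul_eq_mul, nsmul_eq_mul]
  linear_combination ψ x j * ha

/-- The image of an injective linear map has full rank, so the quotient is torsion; an annihilator
is a unit times a power of `p`. -/
theorem exists_pow_nsmul_eq_of_injective {p : ℕ} [Fact p.Prime] {J : Type*} [Finite J]
    (ψ : (J → ℤ_[p]) →+ (J → ℤ_[p])) (hψ : Function.Injective ψ) (x : J → ℤ_[p]) :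
    ∃ (k : ℕ) (y : J → ℤ_[p]), ψ y = p ^ k • x := by
  let L : (J → ℤ_[p]) →ₗ[ℤ_[p]] (J → ℤ_[p]) :=
    { ψ with map_smul' := fun a x => map_padicInt_smul ψ a x }
  have hL : Function.Injective L := hψ
  have hrank := Submodule.finrank_quotient_add_finrank (LinearMap.range L)
  rw [LinearMap.finrank_range_of_inj hL, Nat.add_eq_right, Module.finrank_eq_zero_iff] at hrank
  obtain ⟨a, ha, hax⟩ := hrank (Submodule.Quotient.mk x)
  rw [← Submodule.Quotient.mk_smul, Submodule.Quotient.mk_eq_zero] at hax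
  have h2 : (p ^ a.valuation : ℤ_[p]) • x ∈ LinearMap.range L := by
    rw [PadicInt.unitCoeff_spec ha, mul_smul] at hax
    exact (Submodule.smul_mem_iff_of_isUnit _ (PadicInt.unitCoeff ha).isUnit).1 hax
  obtain ⟨y, hy⟩ := h2
  refine ⟨a.valuation, y, ?_⟩
  rw [← Nat.cast_smul_eq_nsmul ℤ_[p], Nat.cast_pow]
  exact hy

theorem nonempty_padicInt_addEquiv {p q : ℕ} [Fact p.Prime] [Fact q.Prime] (h : p = q) :
    Nonempty (ℤ_[p] ≃+ ℤ_[q]) := by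
  subst h
  exact ⟨AddEquiv.refl _⟩

theorem exists_nsmul_eq_of_injective_pi {ι : Type*} [Finite ι] (p : ι → ℕ)
    [∀ i, Fact (p i).Prime] (φ : (∀ i, ℤ_[p i]) →+ ∀ i, ℤ_[p i]) (hφ : Function.Injective φ)
    (x : ∀ i, ℤ_[p i]) : ∃ n : ℕ, n ≠ 0 ∧ ∃ y, φ y = n • x := by
  classical
  have hsingle : ∀ i (z : ℤ_[p i]), ∃ n : ℕ, n ≠ 0 ∧ ∃ y, φ y = n • Pi.single i z := by
    intro i₀ z
    set q := p i₀
    have : Fact q.Prime := inferInstanceAs (Fact (p i₀).Prime)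
    let J := {i // p i = q}
    have he : ∀ j : J, Nonempty (ℤ_[p j] ≃+ ℤ_[q]) := fun j => nonempty_padicInt_addEquiv j.2
    let e (j : J) : ℤ_[p j] ≃+ ℤ_[q] := (he j).some
    let inc : (J → ℤ_[q]) →+ ∀ i, ℤ_[p i] :=
      AddMonoidHom.mk' (fun v i => if h : p i = q then (e ⟨i, h⟩).symm (v ⟨i, h⟩) else 0) <| by
        intro v w
        funext i
        by_cases h : p i = q <;> simp [h]
    let proj : (∀ i, ℤ_[p i]) →+ (J → ℤ_[q]) :=
      AddMonoidHom.mk' (fun a j => e j (a j)) fun a b => by ext j; simp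
    have hinc : ∀ a : ∀ i, ℤ_[p i], (∀ i, p i ≠ q → a i = 0) → inc (proj a) = a := by
      intro a ha
      funext i
      change (if h : p i = q then (e ⟨i, h⟩).symm (e ⟨i, h⟩ (a i)) else 0) = a i
      split_ifs with h
      · exact (e ⟨i, h⟩).symm_apply_apply _
      · exact (ha i h).symm
    have hinj : Function.Injective inc := by
      intro v w hvw
      funext j
      have h := congrFun hvw j
      change (if h : p j = q then (e ⟨j, h⟩).symm (v ⟨j, h⟩) else 0 : ℤ_[p j]) =
        (if h : p j = q then (e ⟨j, h⟩).symm (w ⟨j, h⟩) else 0 : ℤ_[p j]) at h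
      rw [dif_pos j.2, dif_pos j.2] at h
      exact (e j).symm.injective h
    -- Elements of the `q`-block are divisible by all powers of any other prime `p i`, so their
    -- images have zero coordinate in `ℤ_[p i]`.
    have hφinc : ∀ v, inc (proj (φ (inc v))) = φ (inc v) := by
      refine fun v => hinc _ fun i hi => padicInt_eq_zero_of_forall_pow (p i) _ fun k => ?_
      choose w hw using fun j => padicInt_exists_pow_nsmul (Fact.out : (p i).Prime) hi.symm k (v j)
      exact ⟨φ (inc w) i, by rw [← show p i ^ k • w = v from funext hw, map_nsmul, map_nsmul]; rfl⟩
    obtain ⟨k, y, hy⟩ := exists_pow_nsmul_eq_of_injective ((proj.comp φ).comp inc)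
      (fun v w h => hinj (hφ (by
        rw [← hφinc v, ← hφinc w]
        exact congrArg inc h))) (proj (Pi.single i₀ z))
    refine ⟨q ^ k, pow_ne_zero k (Fact.out : q.Prime).ne_zero, inc y, ?_⟩
    rw [← hφinc y]
    change inc (((proj.comp φ).comp inc) y) = _
    rw [hy, map_nsmul, hinc]
    intro i hi
    exact Pi.single_eq_of_ne (M := fun i => ℤ_[p i]) (fun h : i = i₀ => hi (congrArg p h)) z
  have : Fintype ι := Fintype.ofFinite ι
  choose n hn y hy using fun i => hsingle i (x i)
  refine ⟨∏ i, n i, Finset.prod_ne_zero_iff.2 fun i _ => hn i,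
    ∑ i, (∏ j ∈ Finset.univ.erase i, n j) • y i, ?_⟩
  rw [map_sum]
  conv_rhs => rw [← Finset.univ_sum_single x, Finset.smul_sum]
  refine Finset.sum_congr rfl fun i _ => ?_
  rw [map_nsmul, hy, smul_smul, Finset.prod_erase_mul _ _ (Finset.mem_univ i)]

theorem isRelativelyCoHopfian_of_torsion_cokernel {G : Type*} [AddCommGroup G]
    [IsAddTorsionFree G]
    (h : ∀ φ : G →+ G, Function.Injective φ → ∀ x, ∃ n : ℕ, n ≠ 0 ∧ ∃ y, φ y = n • x) :
    IsRelativelyCoHopfian G := by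
  rintro H A - ⟨B, hinf, hsup⟩ hne
  refine ⟨fun e => hne ?_⟩
  have hB : B = ⊥ := by
    rw [eq_bot_iff]
    intro x hx
    obtain ⟨n, hn, y, hy⟩ := h (A.subtype.comp e.toAddMonoidHom)
      (Subtype.val_injective.comp e.injective) x
    have hmem : n • x ∈ A ⊓ B := ⟨hy ▸ (e y).2, B.nsmul_mem hx n⟩
    rw [hinf, AddSubgroup.mem_bot] at hmem
    exact (nsmul_eq_zero_iff_right hn).1 hmem
  rw [← hsup, hB, sup_bot_eq]

theorem isRelativelyCoHopfian_of_addEquiv {G : Type*} [AddCommGroup G] [IsAddTorsionFree G]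
    {n : ℕ} (p : Fin n → ℕ) [∀ i, Fact (p i).Prime] (e : G ≃+ ⨁ i : Fin n, ℤ_[p i]) :
    IsRelativelyCoHopfian G := by
  let c : G ≃+ ∀ i, ℤ_[p i] := e.trans (DirectSum.addEquivProd _)
  refine isRelativelyCoHopfian_of_torsion_cokernel fun φ hφ x => ?_
  obtain ⟨n, hn, y, hy⟩ := exists_nsmul_eq_of_injective_pi p
    ((c.toAddMonoidHom.comp φ).comp c.symm.toAddMonoidHom)
    (c.injective.comp (hφ.comp c.symm.injective)) (c x)
  refine ⟨n, hn, c.symm y, c.injective ?_⟩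
  rw [map_nsmul]
  exact hy

end AbelianGroup

theorem proposition2p33 (G : Type u) [AddCommGroup G]
    (hred : AbelianGroup.IsReducedGroup G)
    (hac : AbelianGroup.IsAlgebraicallyCompact G)
    (htf : IsAddTorsionFree G) :
    AbelianGroup.IsRelativelyCoHopfian G ↔
      ∃ (n : ℕ) (p : Fin n → ℕ) (_ : ∀ i, Fact (p i).Prime),
        Nonempty (G ≃+ ⨁ i : Fin n, ℤ_[p i]) := by
  refine ⟨AbelianGroup.exists_addEquiv_directSum hred hac, ?_⟩
  rintro ⟨n, p, _, ⟨e⟩⟩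
  exact AbelianGroup.isRelativelyCoHopfian_of_addEquiv p e
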